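/- Let $\mathcal{E}$ be an elementary topos with chosen finite products, and let $(Q,\otimes,k,\leq)$ be an internal partially ordered commutative monoid in $\mathcal{E}$ (an internal commutative monoid with an internal partial order for which $\otimes$ is monotone). *Signatures and interpretations.* A signature $(\Sigma,E)$ consists of a set $\Sigma$ of operation symbols of finite arity and a set $E$ of equations between $\Sigma$-terms in finitely many variables. A $\Sigma$-term over variables $x_1,\dots,x_n$ is *linear* (*affine*, *relevant*) if it uses each of $x_1,\dots,x_n$ exactly once (at most once, at least once); every term is *cartesian*. Let $c$ be one of these four classes. A *$c$-interpretation* $i:(\Sigma_1,E_1)\to(\Sigma_2,E_2)$ assigns to every $n$-ary $\sigma\in\Sigma_1$ a $\Sigma_2$-term $i(\sigma)$ over $x_1,\dots,x_n$ that belongs to the class $c$, such that the translations of the equations in $E_1$ are provable from $E_2$ in equational logic. Signatures and $c$-interpretations form a category, with composition by substitution of terms. A $(\Sigma,E)$-algebra in $\mathcal{E}$ is an object $A$ with a morphism $\sigma^A:A^n\to A$ for every $n$-ary $\sigma\in\Sigma$, satisfying the equations in $E$; every term $\tau$ in $n$ variables has a derived operation $\tau^A:A^n\to A$. *Algebraic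 $Q$-spans.* A $Q$-span $A\to B$ is a quadruple $(X,f:X\to A,g:X\to B,\chi:X\to Q)$. $Q$-spans are identified if there is an isomorphism of their apexes commuting with the legs and with $\chi$. The composite of $(X,f,g,\chi)$ with $(X',f',g',\chi')$ is formed by the pullback of $g$ and $f'$, with characteristic morphism $(x,x')\mapsto\chi(x)\otimes\chi'(x')$; the identity on $A$ is $(A,1,1,x\mapsto k)$. A $Q$-span between $\Sigma$-algebras is *algebraic* if for each $n$-ary $\sigma\in\Sigma$ the internal language of $\mathcal{E}$ validates $$\forall x_1,\dots,x_n\,\exists x.\; f(x)=\sigma(f(x_1),\dots,f(x_n))\wedge g(x)=\sigma(g(x_1),\dots,g(x_n))\wedge \chi(x_1)\otimes\dots\otimes\chi(x_n)\leq\chi(x).$$ It is *affine* if $\forall x_1,x_2.\,\chi(x_1)\otimes\chi(x_2)\leq\chi(x_1)$ is valid, *relevant* if $\forall x.\,\chi(x)\leq\chi(x)\otimes\chi(x)$ is valid, *cartesian* if it is both; every $Q$-span is *linear*. For a class $c$, let $\mathbf{Span}_c^{(\Sigma,E)}(Q)$ be the category of $(\Sigma,E)$-algebras in $\mathcal{E}$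 and (isomorphism classes of) algebraic $Q$-spans of class $c$. It is monoidal: the tensor product of algebras is their product in $\mathcal{E}$ with componentwise operations, the unit is the terminal algebra, the tensor product of $Q$-spans is $(X\times X',f\times f',g\times g',(x,x')\mapsto\chi(x)\otimes\chi'(x'))$, and the coherence isomorphisms are the graphs of those of the finite products in $\mathcal{E}$. **Theorem.** Let $c$ be one of the classes linear, affine, relevant, cartesian. Every $c$-interpretation $i:(\Sigma_1,E_1)\to(\Sigma_2,E_2)$ induces a strict monoidal functor $$i^*:\mathbf{Span}_c^{(\Sigma_2,E_2)}(Q)\to\mathbf{Span}_c^{(\Sigma_1,E_1)}(Q)$$ which sends an algebra $A$ to the algebra with the same underlying object in which each $\sigma\in\Sigma_1$ is interpreted by the derived operation $i(\sigma)^A$, and which is the identity on morphisms (it does not change the underlying $Q$-spans). The assignment $i\mapsto i^*$ is contravariantly functorial: $1^*=\mathrm{Id}$, and $(j\circ i)^*=i^*\circ j^*$ for $c$-interpretations $i:(\Sigma_1,E_1)\to(\Sigma_2,E_2)$ and $j:(\Sigma_2,E_2)\to(\Sigma_3,E_3)$. -/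

import Mathlib

open CategoryTheory CategoryTheory.Limits CategoryTheory.MonoidalCategory
open CategoryTheory.CartesianMonoidalCategory
open scoped CategoryTheory.MonObj

universe w v u

namespace QSpans

/-! ### Internal partially ordered commutative monoids -/

/-- An internal partially ordered commutative monoid in a category `E` with finite products:
an internal commutative monoid `Q` with an internal order relation (a subobject of `Q × Q`) which
is reflexive, transitive and antisymmetric and for which the multiplication is monotone. The
axioms are stated for generalized elements `T ⟶ Q`; on these, `*` is
`lift p q ≫ μ : T ⟶ Q × Q ⟶ Q`. -/
structure OrdCommMonoid (E : Type u) [Category.{v} E] [CartesianMonoidalCategory E]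
    [BraidedCategory E] where
  /-- the underlying object -/
  obj : E
  [mon : MonObj obj]
  [comm : IsCommMonObj obj]
  /-- the order relation -/
  le : Subobject (obj ⊗ obj)
  le_refl : ∀ {T : E} (p : T ⟶ obj), le.Factors (lift p p)
  le_trans : ∀ {T : E} (p q r : T ⟶ obj),
    le.Factors (lift p q) → le.Factors (lift q r) → le.Factors (lift p r)
  le_antisymm : ∀ {T : E} (p q : T ⟶ obj),
    le.Factors (lift p q) → le.Factors (lift q p) → p = q
  mul_mono : ∀ {T : E} (p p' q q' : T ⟶ obj),
    le.Factors (lift p p') → le.Factors (lift q q') → le.Factors (lift (p * q) (p' * q'))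

attribute [instance] OrdCommMonoid.mon OrdCommMonoid.comm

/-! ### Auxiliary facts on finite products -/

theorem isPullback_tensor {E : Type u} [Category.{v} E] [CartesianMonoidalCategory E]
    {P X Y Z P' X' Y' Z' : E} {p : P ⟶ X} {q : P ⟶ Y} {f : X ⟶ Z}
    {g : Y ⟶ Z} {p' : P' ⟶ X'} {q' : P' ⟶ Y'} {f' : X' ⟶ Z'} {g' : Y' ⟶ Z'}
    (h : IsPullback p q f g) (h' : IsPullback p' q' f' g') :
    IsPullback (p ⊗ₘ p') (q ⊗ₘ q') (f ⊗ₘ f') (g ⊗ₘ g') := by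
  refine ⟨⟨by simp [h.w, h'.w]⟩, ⟨PullbackCone.IsLimit.mk _
    (fun c => lift (h.lift (c.fst ≫ fst _ _) (c.snd ≫ fst _ _) ?_)
      (h'.lift (c.fst ≫ snd _ _) (c.snd ≫ snd _ _) ?_)) ?_ ?_ ?_⟩⟩
  · simpa using c.condition =≫ fst _ _
  · simpa using c.condition =≫ snd _ _
  · intro c; ext <;> simp
  · intro c; ext <;> simp
  · intro c m h1 h2
    ext
    · apply h.hom_ext
      · simpa using h1 =≫ fst _ _
      · simpa using h2 =≫ fst _ _
    · apply h'.hom_ext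
      · simpa using h1 =≫ snd _ _
      · simpa using h2 =≫ snd _ _

section Spans

variable {E : Type u} [Category.{v} E] [CartesianMonoidalCategory E] [BraidedCategory E]

/-- The order induced on generalized elements of `Q`. -/
def OrdCommMonoid.Le (Q : OrdCommMonoid E) {T : E} (p q : T ⟶ Q.obj) : Prop :=
  Q.le.Factors (lift p q)

theorem OrdCommMonoid.Le.comp {Q : OrdCommMonoid E} {T U : E} {p q : T ⟶ Q.obj}
    (h : Q.Le p q) (e : U ⟶ T) : Q.Le (e ≫ p) (e ≫ q) := by
  have := Subobject.factors_of_factors_right e h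
  rwa [comp_lift] at this

theorem comp_prod {Q : OrdCommMonoid E} {T U : E} (e : U ⟶ T) {J : Type*} (s : Finset J)
    (p : J → (T ⟶ Q.obj)) : e ≫ ∏ i ∈ s, p i = ∏ i ∈ s, e ≫ p i := by
  classical
  induction s using Finset.induction_on with
  | empty => simp [MonObj.comp_one]
  | insert a s ha ih => rw [Finset.prod_insert ha, Finset.prod_insert ha, MonObj.comp_mul, ih]

theorem OrdCommMonoid.Le.prod {Q : OrdCommMonoid E} {T : E} {J : Type*} (s : Finset J)
    {p q : J → (T ⟶ Q.obj)} (h : ∀ i ∈ s, Q.Le (p i) (q i)) :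
    Q.Le (∏ i ∈ s, p i) (∏ i ∈ s, q i) := by
  classical
  induction s using Finset.induction_on with
  | empty => exact Q.le_refl _
  | insert a s ha ih =>
    rw [Finset.prod_insert ha, Finset.prod_insert ha]
    exact Q.mul_mono _ _ _ _ (h a (by simp)) (ih fun i hi => h i (by simp [hi]))

theorem lift_mul' {Q : OrdCommMonoid E} {T : E} (p q : T ⟶ Q.obj) :
    lift p q ≫ MonObj.mul = p * q := rfl

theorem tensorHom_mul' {Q : OrdCommMonoid E} {S T : E} (p : S ⟶ Q.obj) (q : T ⟶ Q.obj) :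
    (p ⊗ₘ q) ≫ MonObj.mul = (fst S T ≫ p) * (snd S T ≫ q) := by
  rw [Hom.mul_def]
  congr 1
  ext <;> simp

/-! ### `Q`-spans and their isomorphism classes -/

/-- A `Q`-span from `A` to `B`: a span with a characteristic morphism from its apex to `Q`. -/
structure QSpan (Q : OrdCommMonoid E) (A B : E) where
  apex : E
  left : apex ⟶ A
  right : apex ⟶ B
  chr : apex ⟶ Q.obj

namespace QSpan

variable {Q : OrdCommMonoid E} {A B C D : E}

/-- Two `Q`-spans are isomorphic if there is an isomorphism of the apexes that commutes with the
legs and the characteristic morphisms. -/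
def IsIsomorphic (s t : QSpan Q A B) : Prop :=
  ∃ i : s.apex ≅ t.apex,
    i.hom ≫ t.left = s.left ∧ i.hom ≫ t.right = s.right ∧ i.hom ≫ t.chr = s.chr

theorem IsIsomorphic.symm {s t : QSpan Q A B} : s.IsIsomorphic t → t.IsIsomorphic s := by
  rintro ⟨i, h1, h2, h3⟩
  exact ⟨i.symm, by simp [← h1], by simp [← h2], by simp [← h3]⟩

instance setoid (Q : OrdCommMonoid E) (A B : E) : Setoid (QSpan Q A B) where
  r := IsIsomorphic
  iseqv :=
    ⟨fun s => ⟨Iso.refl _, by simp⟩, IsIsomorphic.symm, by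
      rintro s t r ⟨i, h1, h2, h3⟩ ⟨j, k1, k2, k3⟩
      exact ⟨i ≪≫ j, by simp [h1, k1], by simp [h2, k2], by simp [h3, k3]⟩⟩

/-- The graph of a morphism `f : A ⟶ B`: the `Q`-span `(A, 1, f, χ_k)`. -/
abbrev graph (Q : OrdCommMonoid E) (f : A ⟶ B) : QSpan Q A B where
  apex := A
  left := 𝟙 A
  right := f
  chr := toUnit A ≫ MonObj.one

/-- The `Q`-span obtained from `s` and `t` by means of a commutative square with vertex `P` over
the legs in the middle. -/
abbrev compOf (s : QSpan Q A B) (t : QSpan Q B C) {P : E} (p₁ : P ⟶ s.apex) (p₂ : P ⟶ t.apex) :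
    QSpan Q A C where
  apex := P
  left := p₁ ≫ s.left
  right := p₂ ≫ t.right
  chr := lift (p₁ ≫ s.chr) (p₂ ≫ t.chr) ≫ MonObj.mul

/-- Composition of `Q`-spans by pullback. -/
noncomputable abbrev comp [HasFiniteLimits E] (s : QSpan Q A B) (t : QSpan Q B C) : QSpan Q A C :=
  compOf s t (pullback.fst s.right t.left) (pullback.snd s.right t.left)

/-- The tensor product of `Q`-spans, given by finite products in `E`. -/
abbrev tensor (s : QSpan Q A B) (t : QSpan Q C D) : QSpan Q (A ⊗ C) (B ⊗ D) where
  apex := s.apex ⊗ t.apex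
  left := s.left ⊗ₘ t.left
  right := s.right ⊗ₘ t.right
  chr := (s.chr ⊗ₘ t.chr) ≫ MonObj.mul

theorem graph_chr (f : A ⟶ B) : (graph Q f).chr = 1 := rfl

theorem compOf_chr (s : QSpan Q A B) (t : QSpan Q B C) {P : E} (p₁ : P ⟶ s.apex)
    (p₂ : P ⟶ t.apex) : (compOf s t p₁ p₂).chr = (p₁ ≫ s.chr) * (p₂ ≫ t.chr) := rfl

theorem tensor_chr (s : QSpan Q A B) (t : QSpan Q C D) :
    (tensor s t).chr = (fst _ _ ≫ s.chr) * (snd _ _ ≫ t.chr) := tensorHom_mul' _ _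

end QSpan

open QSpan

/-- Isomorphism classes of `Q`-spans. -/
def SpanClass (Q : OrdCommMonoid E) (A B : E) : Type (max u v) := Quotient (setoid Q A B)

namespace SpanClass

variable {Q : OrdCommMonoid E} {A B C D : E}

/-- The isomorphism class of a `Q`-span. -/
def mk (s : QSpan Q A B) : SpanClass Q A B := Quotient.mk _ s

theorem exists_rep (m : SpanClass Q A B) : ∃ s, mk s = m := Quotient.exists_rep m

theorem mk_eq {s t : QSpan Q A B} (i : s.apex ≅ t.apex) (h1 : i.hom ≫ t.left = s.left)
    (h2 : i.hom ≫ t.right = s.right) (h3 : i.hom ≫ t.chr = s.chr) : mk s = mk t :=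
  Quotient.sound ⟨i, h1, h2, h3⟩

theorem mk_compOf_eq (s s' : QSpan Q A B) (t t' : QSpan Q B C) {P P' : E}
    {p₁ : P ⟶ s.apex} {p₂ : P ⟶ t.apex} {q₁ : P' ⟶ s'.apex} {q₂ : P' ⟶ t'.apex}
    (hP : IsPullback p₁ p₂ s.right t.left) (hP' : IsPullback q₁ q₂ s'.right t'.left)
    (i : s.apex ≅ s'.apex) (hi : i.hom ≫ s'.left = s.left ∧ i.hom ≫ s'.right = s.right ∧
      i.hom ≫ s'.chr = s.chr)
    (j : t.apex ≅ t'.apex) (hj : j.hom ≫ t'.left = t.left ∧ j.hom ≫ t'.right = t.right ∧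
      j.hom ≫ t'.chr = t.chr) :
    mk (compOf s t p₁ p₂) = mk (compOf s' t' q₁ q₂) := by
  obtain ⟨i1, i2, i3⟩ := hi
  obtain ⟨j1, j2, j3⟩ := hj
  have hQ : IsPullback (p₁ ≫ i.hom) (p₂ ≫ j.hom) s'.right t'.left :=
    IsPullback.of_iso hP (Iso.refl _) i j (Iso.refl _) (by simp) (by simp) (by simp [i2])
      (by simp [j1])
  refine mk_eq (hQ.isoIsPullback _ _ hP') ?_ ?_ ?_
  · simp [compOf, i1]
  · simp [compOf, j2]
  · rw [compOf_chr, compOf_chr, MonObj.comp_mul]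
    simp [i3, j3]

/-- The tensor product of isomorphism classes of `Q`-spans. -/
def tensor : SpanClass Q A B → SpanClass Q C D → SpanClass Q (A ⊗ C) (B ⊗ D) :=
  Quotient.map₂ QSpan.tensor fun s s' hs t t' ht => by
    obtain ⟨i, i1, i2, i3⟩ := hs
    obtain ⟨j, j1, j2, j3⟩ := ht
    refine ⟨i ⊗ᵢ j, ?_, ?_, ?_⟩
    · simp [i1, j1]
    · simp [i2, j2]
    · simp [i3, j3]

theorem tensor_graph (f : A ⟶ B) (g : C ⟶ D) :
    tensor (mk (graph Q f)) (mk (graph Q g)) = mk (graph Q (f ⊗ₘ g)) := by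
  refine mk_eq (Iso.refl _) ?_ ?_ ?_
  · simp [graph, QSpan.tensor]
  · simp [graph, QSpan.tensor]
  · rw [tensor_chr, graph_chr, graph_chr, graph_chr]
    simp [MonObj.comp_one]

variable [HasFiniteLimits E]

/-- Composition of isomorphism classes of `Q`-spans. -/
noncomputable def comp : SpanClass Q A B → SpanClass Q B C → SpanClass Q A C :=
  Quotient.map₂ QSpan.comp fun s s' hs t t' ht => Quotient.exact (by
    obtain ⟨i, hi⟩ := hs
    obtain ⟨j, hj⟩ := ht
    exact mk_compOf_eq s s' t t' (IsPullback.of_hasPullback _ _) (IsPullback.of_hasPullback _ _)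
      i hi j hj)

theorem comp_mk (s : QSpan Q A B) (t : QSpan Q B C) {P : E} {p₁ : P ⟶ s.apex} {p₂ : P ⟶ t.apex}
    (hP : IsPullback p₁ p₂ s.right t.left) : comp (mk s) (mk t) = mk (compOf s t p₁ p₂) :=
  mk_compOf_eq s s t t (IsPullback.of_hasPullback _ _) hP (Iso.refl _) (by simp) (Iso.refl _)
    (by simp)

theorem comp_mk_graph (s : QSpan Q A B) (f : B ⟶ C) :
    comp (mk s) (mk (graph Q f)) = mk ⟨s.apex, s.left, s.right ≫ f, s.chr⟩ := by
  rw [comp_mk s (graph Q f) (IsPullback.id_horiz s.right)]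
  refine mk_eq (Iso.refl _) ?_ ?_ ?_
  · simp [compOf]
  · simp [compOf, graph]
  · rw [compOf_chr, graph_chr, MonObj.comp_one]; simp

theorem comp_graph_mk (f : A ⟶ B) (s : QSpan Q B C) {P : E} {p₁ : P ⟶ A} {p₂ : P ⟶ s.apex}
    (hP : IsPullback p₁ p₂ f s.left) :
    comp (mk (graph Q f)) (mk s) = mk ⟨P, p₁, p₂ ≫ s.right, p₂ ≫ s.chr⟩ := by
  rw [comp_mk (graph Q f) s hP]
  refine mk_eq (Iso.refl _) ?_ ?_ ?_
  · simp [compOf, graph]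
  · simp [compOf]
  · rw [compOf_chr, graph_chr, MonObj.comp_one]; simp

theorem comp_graph_iso (f : A ≅ B) (s : QSpan Q B C) :
    comp (mk (graph Q f.hom)) (mk s) = mk ⟨s.apex, s.left ≫ f.inv, s.right, s.chr⟩ := by
  rw [comp_graph_mk f.hom s (p₁ := s.left ≫ f.inv) (p₂ := 𝟙 _)
    (IsPullback.of_vert_isIso ⟨by simp⟩)]
  simp

theorem graph_comp (f : A ⟶ B) (g : B ⟶ C) :
    comp (mk (graph Q f)) (mk (graph Q g)) = mk (graph Q (f ≫ g)) := by
  rw [comp_mk_graph]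

theorem id_comp' (m : SpanClass Q A B) : comp (mk (graph Q (𝟙 A))) m = m := by
  obtain ⟨s, rfl⟩ := exists_rep m
  exact (comp_graph_iso (Iso.refl A) s).trans (by simp)

theorem comp_id' (m : SpanClass Q A B) : comp m (mk (graph Q (𝟙 B))) = m := by
  obtain ⟨s, rfl⟩ := exists_rep m
  rw [comp_mk_graph]; simp

theorem assoc' (m : SpanClass Q A B) (n : SpanClass Q B C) (l : SpanClass Q C D) :
    comp (comp m n) l = comp m (comp n l) := by
  obtain ⟨s, rfl⟩ := exists_rep m
  obtain ⟨t, rfl⟩ := exists_rep n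
  obtain ⟨r, rfl⟩ := exists_rep l
  have h1 := IsPullback.of_hasPullback s.right t.left
  have h2 := IsPullback.of_hasPullback t.right r.left
  have h3 := IsPullback.of_hasPullback (pullback.snd s.right t.left) (pullback.fst t.right r.left)
  rw [comp_mk s t h1, comp_mk t r h2, comp_mk (compOf s t _ _) r (h3.paste_vert h2),
    comp_mk s (compOf t r _ _) (h3.paste_horiz h1)]
  refine mk_eq (Iso.refl _) ?_ ?_ ?_
  · simp [compOf]
  · simp [compOf]
  · simp only [lift_mul', MonObj.comp_mul, Iso.refl_hom, Category.id_comp, mul_assoc,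
      Category.assoc, lift_mul', reassoc_of% h3.w]

theorem tensor_comp' {A' B' C' : E} (m : SpanClass Q A B) (n : SpanClass Q B C)
    (m' : SpanClass Q A' B') (n' : SpanClass Q B' C') :
    comp (tensor m m') (tensor n n') = tensor (comp m n) (comp m' n') := by
  obtain ⟨s, rfl⟩ := exists_rep m
  obtain ⟨t, rfl⟩ := exists_rep n
  obtain ⟨s', rfl⟩ := exists_rep m'
  obtain ⟨t', rfl⟩ := exists_rep n'
  have h1 := IsPullback.of_hasPullback s.right t.left
  have h2 := IsPullback.of_hasPullback s'.right t'.left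
  rw [comp_mk s t h1, comp_mk s' t' h2]
  refine (comp_mk (s.tensor s') (t.tensor t') (isPullback_tensor h1 h2)).trans ?_
  refine mk_eq (Iso.refl _) ?_ ?_ ?_
  · simp [compOf, QSpan.tensor]
  · simp [compOf, QSpan.tensor]
  · simp only [lift_mul', tensorHom_mul', MonObj.comp_mul, Iso.refl_hom, Category.id_comp,
      tensorHom_fst_assoc, tensorHom_snd_assoc]
    exact mul_mul_mul_comm _ _ _ _

end SpanClass

/-! ### The monoidal category of `Q`-spans -/

/-- The objects of `E`, as objects of the category of `Q`-spans. -/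
@[ext]
structure SpanCat (Q : OrdCommMonoid E) : Type u where
  obj : E

variable [HasFiniteLimits E]

noncomputable instance (Q : OrdCommMonoid E) : Category.{max u v} (SpanCat Q) where
  Hom A B := SpanClass Q A.obj B.obj
  id A := SpanClass.mk (graph Q (𝟙 A.obj))
  comp m n := SpanClass.comp m n
  id_comp := SpanClass.id_comp'
  comp_id := SpanClass.comp_id'
  assoc := SpanClass.assoc'

/-- The graph functor. -/
noncomputable def graphFunctor (Q : OrdCommMonoid E) : E ⥤ SpanCat Q where
  obj A := ⟨A⟩
  map f := SpanClass.mk (graph Q f)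
  map_id _ := rfl
  map_comp f g := (SpanClass.graph_comp f g).symm

/-- The monoidal operations on `Q`-spans; the coherence isomorphisms are the graphs of those of
the finite products in `E`. -/
noncomputable instance (Q : OrdCommMonoid E) : MonoidalCategoryStruct (SpanCat Q) where
  tensorObj A B := ⟨A.obj ⊗ B.obj⟩
  tensorHom m n := SpanClass.tensor m n
  whiskerLeft A _ _ m := SpanClass.tensor (SpanClass.mk (graph Q (𝟙 A.obj))) m
  whiskerRight m A := SpanClass.tensor m (SpanClass.mk (graph Q (𝟙 A.obj)))
  tensorUnit := ⟨𝟙_ E⟩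
  associator A B C := (graphFunctor Q).mapIso (α_ A.obj B.obj C.obj)
  leftUnitor A := (graphFunctor Q).mapIso (λ_ A.obj)
  rightUnitor A := (graphFunctor Q).mapIso (ρ_ A.obj)

theorem graphFunctor_tensor (Q : OrdCommMonoid E) {A B C D : E} (f : A ⟶ B) (g : C ⟶ D) :
    (graphFunctor Q).map f ⊗ₘ (graphFunctor Q).map g = (graphFunctor Q).map (f ⊗ₘ g) :=
  SpanClass.tensor_graph f g

theorem graph_comp_of_iso (Q : OrdCommMonoid E) {A A' B B' : E} (f : A ≅ A') (g : B ⟶ B')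
    (s : QSpan Q A B) (t : QSpan Q A' B') (i : s.apex ≅ t.apex)
    (h1 : i.hom ≫ t.left = s.left ≫ f.hom) (h2 : i.hom ≫ t.right = s.right ≫ g)
    (h3 : i.hom ≫ t.chr = s.chr) :
    SpanClass.comp (SpanClass.mk s) (SpanClass.mk (graph Q g)) =
      SpanClass.comp (SpanClass.mk (graph Q f.hom)) (SpanClass.mk t) := by
  rw [SpanClass.comp_mk_graph, SpanClass.comp_graph_iso]
  refine SpanClass.mk_eq i ?_ h2 h3
  simp [reassoc_of% h1]

noncomputable instance (Q : OrdCommMonoid E) : MonoidalCategory (SpanCat Q) :=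
  MonoidalCategory.ofTensorHom
    (id_tensorHom_id := fun A B => by
      refine (SpanClass.tensor_graph (𝟙 A.obj) (𝟙 B.obj)).trans ?_
      rw [id_tensorHom_id]; rfl)
    (id_tensorHom := fun _ _ _ _ => rfl)
    (tensorHom_id := fun _ _ => rfl)
    (tensorHom_comp_tensorHom := fun _ _ _ _ => SpanClass.tensor_comp' _ _ _ _)
    (associator_naturality := fun {X₁ X₂ X₃ Y₁ Y₂ Y₃} f₁ f₂ f₃ => by
      obtain ⟨s, rfl⟩ := SpanClass.exists_rep f₁
      obtain ⟨t, rfl⟩ := SpanClass.exists_rep f₂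
      obtain ⟨r, rfl⟩ := SpanClass.exists_rep f₃
      refine graph_comp_of_iso Q (α_ X₁.obj X₂.obj X₃.obj) _
        ((s.tensor t).tensor r) (s.tensor (t.tensor r)) (α_ s.apex t.apex r.apex) ?_ ?_ ?_
      · simp [QSpan.tensor]
      · simp [QSpan.tensor]
      · simp only [tensorHom_mul', MonObj.comp_mul, mul_assoc, associator_hom_fst_assoc,
          associator_hom_snd_fst_assoc, associator_hom_snd_snd_assoc])
    (leftUnitor_naturality := fun {X Y} f => by
      obtain ⟨s, rfl⟩ := SpanClass.exists_rep f
      refine graph_comp_of_iso Q (λ_ X.obj) _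
        ((graph Q (𝟙 (𝟙_ E))).tensor s) s (λ_ s.apex) ?_ ?_ ?_
      · simp [QSpan.tensor, graph]
      · simp [QSpan.tensor, graph]
      · rw [tensor_chr, graph_chr, MonObj.comp_one, one_mul, leftUnitor_hom])
    (rightUnitor_naturality := fun {X Y} f => by
      obtain ⟨s, rfl⟩ := SpanClass.exists_rep f
      refine graph_comp_of_iso Q (ρ_ X.obj) _
        (s.tensor (graph Q (𝟙 (𝟙_ E)))) s (ρ_ s.apex) ?_ ?_ ?_
      · simp [QSpan.tensor, graph]
      · simp [QSpan.tensor, graph]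
      · rw [tensor_chr, graph_chr, MonObj.comp_one, mul_one, rightUnitor_hom])
    (pentagon := fun W X Y Z => by
      have := congrArg (graphFunctor Q).map (MonoidalCategory.pentagon W.obj X.obj Y.obj Z.obj)
      simp only [Functor.map_comp, ← tensorHom_id, ← id_tensorHom] at this
      rw [← graphFunctor_tensor, ← graphFunctor_tensor] at this
      exact this)
    (triangle := fun X Y => by
      have := congrArg (graphFunctor Q).map (MonoidalCategory.triangle X.obj Y.obj)
      simp only [Functor.map_comp, ← tensorHom_id, ← id_tensorHom] at this
      rw [← graphFunctor_tensor, ← graphFunctor_tensor] at this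
      exact this)

end Spans


/-! ### Signatures, terms and interpretations -/

/-- The four kinds of use of variables (resources). -/
inductive Usage
  | linear
  | affine
  | relevant
  | cartesian

/-- A family of operation symbols with finite arities. -/
structure OpSig where
  Op : Type w
  arity : Op → ℕ

/-- Terms over the variables `x_0, …, x_{n-1}`. -/
inductive Term (S : OpSig.{w}) (n : ℕ) : Type w
  | var (i : Fin n) : Term S n
  | app (σ : S.Op) (ts : Fin (S.arity σ) → Term S n) : Term S n

namespace Term

variable {S : OpSig.{w}}

/-- Simultaneous substitution. -/
def subst {m n : ℕ} (f : Fin m → Term S n) : Term S m → Term S n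
  | var i => f i
  | app σ ts => app σ fun j => (ts j).subst f

/-- The number of occurrences of the variable `x_k` in a term. -/
def count {n : ℕ} (k : Fin n) : Term S n → ℕ
  | var i => if i = k then 1 else 0
  | app _ ts => ∑ j, (ts j).count k

/-- A term over `x_0, …, x_{n-1}` is linear (affine, relevant) if it uses each of these variables
exactly (at most, at least) once; every term is cartesian. -/
def HasUsage {n : ℕ} (t : Term S n) : Usage → Prop
  | .linear => ∀ k, t.count k = 1
  | .affine => ∀ k, t.count k ≤ 1
  | .relevant => ∀ k, 1 ≤ t.count k
  | .cartesian => True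

theorem subst_var {n : ℕ} (t : Term S n) : t.subst var = t := by
  induction t with
  | var i => rfl
  | app σ ts ih => simp [subst, ih]

theorem subst_subst {l m n : ℕ} (f : Fin l → Term S m) (g : Fin m → Term S n) (t : Term S l) :
    (t.subst f).subst g = t.subst fun i => (f i).subst g := by
  induction t with
  | var i => rfl
  | app σ ts ih => simp [subst, ih]

theorem count_subst {m n : ℕ} (f : Fin m → Term S n) (k : Fin n) (t : Term S m) :
    (t.subst f).count k = ∑ i, t.count i * (f i).count k := by
  induction t with
  | var i => simp [subst, count]
  | app σ ts ih =>
    simp only [subst, count, ih, Finset.sum_mul]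
    exact Finset.sum_comm

end Term

/-- An algebraic signature `(Σ, E)`: operation symbols with finite arities and, for each `n`, a set
of equations between terms in `n` variables. -/
structure Signature extends OpSig.{w} where
  eqs : ∀ n : ℕ, Set (Term toOpSig n × Term toOpSig n)

/-- Provability in equational logic from the equations of a signature. -/
inductive Provable (S : Signature.{w}) : ∀ {n : ℕ}, Term S.toOpSig n → Term S.toOpSig n → Prop
  | ax {m n : ℕ} {s t : Term S.toOpSig m} (h : (s, t) ∈ S.eqs m)
      (f : Fin m → Term S.toOpSig n) : Provable S (s.subst f) (t.subst f)
  | refl {n : ℕ} (t : Term S.toOpSig n) : Provable S t t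
  | symm {n : ℕ} {s t : Term S.toOpSig n} : Provable S s t → Provable S t s
  | trans {n : ℕ} {s t r : Term S.toOpSig n} : Provable S s t → Provable S t r → Provable S s r
  | congr {n : ℕ} (σ : S.Op) {ts us : Fin (S.arity σ) → Term S.toOpSig n} :
      (∀ j, Provable S (ts j) (us j)) → Provable S (.app σ ts) (.app σ us)

theorem Provable.subst {S : Signature.{w}} {m n : ℕ} {s t : Term S.toOpSig m}
    (h : Provable S s t) (f : Fin m → Term S.toOpSig n) : Provable S (s.subst f) (t.subst f) := by
  induction h with
  | ax h g => rw [Term.subst_subst, Term.subst_subst]; exact .ax h _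
  | refl t => exact .refl _
  | symm _ ih => exact (ih f).symm
  | trans _ _ ih1 ih2 => exact (ih1 f).trans (ih2 f)
  | congr σ _ ih => exact .congr σ fun j => ih j f

theorem Provable.subst_congr {S : Signature.{w}} {m n : ℕ} (t : Term S.toOpSig m)
    {f g : Fin m → Term S.toOpSig n} (h : ∀ i, Provable S (f i) (g i)) :
    Provable S (t.subst f) (t.subst g) := by
  induction t with
  | var i => exact h i
  | app σ ts ih => exact .congr σ ih

/-- The extension to terms of an assignment of derived terms to operation symbols. -/
def Term.translate {S T : OpSig.{w}} (i : ∀ σ : S.Op, Term T (S.arity σ)) {n : ℕ} :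
    Term S n → Term T n
  | .var k => .var k
  | .app σ ts => (i σ).subst fun j => (ts j).translate i

theorem Term.translate_subst {S T : OpSig.{w}} (i : ∀ σ : S.Op, Term T (S.arity σ)) {m n : ℕ}
    (f : Fin m → Term S n) (t : Term S m) :
    (t.subst f).translate i = (t.translate i).subst fun k => (f k).translate i := by
  induction t with
  | var k => rfl
  | app σ ts ih => simp [Term.subst, Term.translate, ih, Term.subst_subst]

theorem Term.translate_id {S : OpSig.{w}} {n : ℕ} (t : Term S n) :
    t.translate (fun σ => .app σ .var) = t := by
  induction t with
  | var k => rfl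
  | app σ ts ih => simp [Term.translate, Term.subst, ih]

theorem Term.translate_translate {S T U : OpSig.{w}} (i : ∀ σ : S.Op, Term T (S.arity σ))
    (j : ∀ σ : T.Op, Term U (T.arity σ)) {n : ℕ} (t : Term S n) :
    (t.translate i).translate j = t.translate fun σ => (i σ).translate j := by
  induction t with
  | var k => rfl
  | app σ ts ih => simp [Term.translate, Term.translate_subst, ih]

theorem Term.HasUsage.translate {S T : OpSig.{w}} {i : ∀ σ : S.Op, Term T (S.arity σ)}
    {c : Usage} (hi : ∀ σ, (i σ).HasUsage c) {n : ℕ} {t : Term S n} (ht : t.HasUsage c) :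
    (t.translate i).HasUsage c := by
  cases c with
  | linear =>
    intro k
    rw [← ht k]
    clear ht
    induction t with
    | var l => rfl
    | app σ ts ih =>
      simp only [Term.translate, Term.count_subst, ih, Term.count]
      exact Finset.sum_congr rfl fun j _ => by rw [hi σ j, one_mul]
  | affine =>
    intro k
    refine le_trans ?_ (ht k)
    clear ht
    induction t with
    | var l => exact le_rfl
    | app σ ts ih =>
      simp only [Term.translate, Term.count_subst, Term.count]
      exact Finset.sum_le_sum fun j _ => (Nat.mul_le_mul (hi σ j) (ih j)).trans (one_mul _).le
  | relevant =>
    intro k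
    refine le_trans (ht k) ?_
    clear ht
    induction t with
    | var l => exact le_rfl
    | app σ ts ih =>
      simp only [Term.translate, Term.count_subst, Term.count]
      exact Finset.sum_le_sum fun j _ =>
        (one_mul _).symm.le.trans (Nat.mul_le_mul (hi σ j) (ih j))
  | cartesian => trivial

/-- A linear (affine, relevant, cartesian) interpretation of the signature `S` in the signature
`T`: each operation symbol of `S` is mapped to a linear (affine, relevant, cartesian) term of `T` of
the same arity, such that the equations of `S` become provable from those of `T`. -/
@[ext]
structure Interpretation (c : Usage) (S T : Signature.{w}) where
  term : ∀ σ : S.Op, Term T.toOpSig (S.arity σ)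
  usage : ∀ σ, (term σ).HasUsage c
  sound : ∀ (n : ℕ) (s t : Term S.toOpSig n), (s, t) ∈ S.eqs n →
    Provable T (s.translate term) (t.translate term)

theorem Interpretation.provable {c : Usage} {S T : Signature.{w}} (i : Interpretation c S T)
    {n : ℕ} {s t : Term S.toOpSig n} (h : Provable S s t) :
    Provable T (s.translate i.term) (t.translate i.term) := by
  induction h with
  | ax h g => rw [Term.translate_subst, Term.translate_subst]; exact (i.sound _ _ _ h).subst _
  | refl t => exact .refl _
  | symm _ ih => exact ih.symm
  | trans _ _ ih1 ih2 => exact ih1.trans ih2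
  | congr σ _ ih => exact Provable.subst_congr _ ih

/-- The category with objects signatures and morphisms the linear (affine, relevant, cartesian)
interpretations. -/
structure SigCat (c : Usage) where
  sig : Signature.{w}

theorem hasUsage_app_var {S : OpSig.{w}} (c : Usage) (σ : S.Op) :
    (Term.app σ Term.var).HasUsage c := by
  cases c <;> simp [Term.HasUsage, Term.count]

instance (c : Usage) : Category (SigCat.{w} c) where
  Hom S T := Interpretation c S.sig T.sig
  id S :=
    { term := fun σ => .app σ .var
      usage := hasUsage_app_var c
      sound := fun n s t h => by
        have := Provable.ax (S := S.sig) h Term.var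
        simpa only [Term.translate_id, Term.subst_var] using this }
  comp i j :=
    { term := fun σ => (i.term σ).translate j.term
      usage := fun σ => (i.usage σ).translate j.usage
      sound := fun n s t h => by
        simpa only [Term.translate_translate] using j.provable (i.sound n s t h) }
  id_comp i := Interpretation.ext (funext fun σ => by simp [Term.translate, Term.subst_var])
  comp_id i := Interpretation.ext (funext fun σ => Term.translate_id _)
  assoc i j k := Interpretation.ext (funext fun σ => Term.translate_translate _ _ _)

/-! ### Algebras in a category with finite products -/

section Algebras

variable {E : Type u} [Category.{v} E] [HasFiniteProducts E]

/-- The power `Aⁿ`. -/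
noncomputable abbrev power (A : E) (n : ℕ) : E := ∏ᶜ fun _ : Fin n => A

/-- An object of `E` with an operation `Aⁿ ⟶ A` for each operation symbol. -/
@[ext]
structure PreAlg (E : Type u) [Category.{v} E] [HasFiniteProducts E] (S : OpSig.{w}) where
  carrier : E
  op : ∀ σ : S.Op, power carrier (S.arity σ) ⟶ carrier

/-- The derived operation `Aⁿ ⟶ A` of a term in `n` variables. -/
noncomputable def PreAlg.derived {S : OpSig.{w}} (A : PreAlg E S) {n : ℕ} :
    Term S n → (power A.carrier n ⟶ A.carrier)
  | .var i => Pi.π _ i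
  | .app σ ts => Pi.lift (fun j => A.derived (ts j)) ≫ A.op σ

/-- The operations of `S` obtained from those of `T` by an assignment of derived terms. -/
noncomputable def PreAlg.reduct {S T : OpSig.{w}} (i : ∀ σ : S.Op, Term T (S.arity σ))
    (A : PreAlg E T) : PreAlg E S where
  carrier := A.carrier
  op σ := A.derived (i σ)

/-- A `(Σ, E)`-algebra in the category `E`. -/
@[ext]
structure Alg (E : Type u) [Category.{v} E] [HasFiniteProducts E] (S : Signature.{w}) extends
    PreAlg E S.toOpSig where
  sat : ∀ (n : ℕ) (s t : Term S.toOpSig n), (s, t) ∈ S.eqs n →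
    toPreAlg.derived s = toPreAlg.derived t

end Algebras

theorem lift_pi_comp {E : Type u} [Category.{v} E] [HasFiniteProducts E] {n : ℕ} {T A B : E}
    (x : Fin n → (T ⟶ A)) (f : A ⟶ B) :
    Pi.lift x ≫ Pi.lift (fun j => Pi.π (fun _ : Fin n => A) j ≫ f) =
      Pi.lift fun j => x j ≫ f := by
  ext j; simp

theorem lift_pi_comp_assoc {E : Type u} [Category.{v} E] [HasFiniteProducts E] {n : ℕ}
    {T A B Z : E} (x : Fin n → (T ⟶ A)) (f : A ⟶ B) (h : power B n ⟶ Z) :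
    Pi.lift x ≫ Pi.lift (fun j => Pi.π (fun _ : Fin n => A) j ≫ f) ≫ h =
      Pi.lift (fun j => x j ≫ f) ≫ h := by
  rw [← Category.assoc, lift_pi_comp]

theorem pi_comp_lift_assoc {E : Type u} [Category.{v} E] [HasFiniteProducts E] {n : ℕ}
    {U T A Z : E} (e : U ⟶ T) (x : Fin n → (T ⟶ A)) (h : power A n ⟶ Z) :
    e ≫ Pi.lift x ≫ h = Pi.lift (fun j => e ≫ x j) ≫ h := by
  rw [← Category.assoc]
  congr 1
  ext j; simp

section AlgebraicSpans

variable {E : Type u} [Category.{v} E] [CartesianMonoidalCategory E] [BraidedCategory E]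
  [HasFiniteLimits E]

/-- The product of two algebras, with componentwise operations. -/
noncomputable abbrev PreAlg.tensor {S : OpSig.{w}} (A B : PreAlg E S) : PreAlg E S where
  carrier := A.carrier ⊗ B.carrier
  op σ := lift (Pi.lift (fun j => Pi.π _ j ≫ fst A.carrier B.carrier) ≫ A.op σ)
    (Pi.lift (fun j => Pi.π _ j ≫ snd A.carrier B.carrier) ≫ B.op σ)

/-- The terminal algebra. -/
noncomputable abbrev PreAlg.unit (E : Type u) [Category.{v} E] [CartesianMonoidalCategory E]
    [HasFiniteLimits E] (S : OpSig.{w}) : PreAlg E S where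
  carrier := 𝟙_ E
  op _ := toUnit _

theorem PreAlg.lift_tensor_op {S : OpSig.{w}} (A B : PreAlg E S) (σ : S.Op) {T : E}
    (x : Fin (S.arity σ) → (T ⟶ A.carrier ⊗ B.carrier)) :
    Pi.lift x ≫ (A.tensor B).op σ =
      lift (Pi.lift (fun j => x j ≫ fst _ _) ≫ A.op σ)
        (Pi.lift (fun j => x j ≫ snd _ _) ≫ B.op σ) := by
  rw [comp_lift, lift_pi_comp_assoc, lift_pi_comp_assoc]

theorem PreAlg.derived_tensor {S : OpSig.{w}} (A B : PreAlg E S) {n : ℕ} (t : Term S n) :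
    (A.tensor B).derived t =
      lift (Pi.lift (fun j => Pi.π _ j ≫ fst A.carrier B.carrier) ≫ A.derived t)
        (Pi.lift (fun j => Pi.π _ j ≫ snd A.carrier B.carrier) ≫ B.derived t) := by
  induction t with
  | var i =>
    simp only [PreAlg.derived, Pi.lift_π]
    exact CartesianMonoidalCategory.hom_ext _ _ (by rw [lift_fst]) (by rw [lift_snd])
  | app σ ts ih =>
    simp only [PreAlg.derived, ih]
    rw [PreAlg.lift_tensor_op]
    simp only [lift_fst, lift_snd, pi_comp_lift_assoc]

/-- The product of two `(Σ, E)`-algebras. -/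
noncomputable abbrev Alg.tensor {S : Signature.{w}} (A B : Alg E S) : Alg E S where
  toPreAlg := A.toPreAlg.tensor B.toPreAlg
  sat n s t h := by
    rw [PreAlg.derived_tensor, PreAlg.derived_tensor, A.sat n s t h, B.sat n s t h]

/-- The terminal `(Σ, E)`-algebra. -/
noncomputable abbrev Alg.unit (E : Type u) [Category.{v} E] [CartesianMonoidalCategory E]
    [HasFiniteLimits E] (S : Signature.{w}) : Alg E S where
  toPreAlg := PreAlg.unit E S.toOpSig
  sat _ _ _ _ := toUnit_unique _ _

/-! ### Algebraic `Q`-spans -/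

namespace QSpan

variable {Q : OrdCommMonoid E} {S : OpSig.{w}}

/-- A `Q`-span between algebras is algebraic if it satisfies, for each operation symbol `σ`,
`∀ x₁ … xₙ, ∃ x, f x = σ(f x₁, …, f xₙ) ∧ g x = σ(g x₁, …, g xₙ) ∧ χ x₁ ⊗ ⋯ ⊗ χ xₙ ≤ χ x`
in the internal language of the topos `E`. By the Kripke–Joyal semantics, this says: for all
generalized elements `x₁, …, xₙ` at a stage `T` there is an epimorphism `e : U ⟶ T` and a
generalized element `x` at the stage `U` with the required property at the stage `U`. -/
def IsAlgebraic (A B : PreAlg E S) (s : QSpan Q A.carrier B.carrier) : Prop :=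
  ∀ (σ : S.Op) (T : E) (x : Fin (S.arity σ) → (T ⟶ s.apex)),
    ∃ (U : E) (e : U ⟶ T) (y : U ⟶ s.apex), Epi e ∧
      y ≫ s.left = e ≫ Pi.lift (fun j => x j ≫ s.left) ≫ A.op σ ∧
      y ≫ s.right = e ≫ Pi.lift (fun j => x j ≫ s.right) ≫ B.op σ ∧
      Q.Le (e ≫ ∏ j, (x j ≫ s.chr)) (y ≫ s.chr)

/-- The axiom `∀ x₁ x₂, χ x₁ ⊗ χ x₂ ≤ χ x₁`. -/
def IsAffine {A B : E} (s : QSpan Q A B) : Prop :=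
  ∀ (T : E) (x₁ x₂ : T ⟶ s.apex), Q.Le ((x₁ ≫ s.chr) * (x₂ ≫ s.chr)) (x₁ ≫ s.chr)

/-- The axiom `∀ x, χ x ≤ χ x ⊗ χ x`. -/
def IsRelevant {A B : E} (s : QSpan Q A B) : Prop :=
  ∀ (T : E) (x : T ⟶ s.apex), Q.Le (x ≫ s.chr) ((x ≫ s.chr) * (x ≫ s.chr))

/-- Linear, affine, relevant and cartesian `Q`-spans. -/
def HasUsage {A B : E} (s : QSpan Q A B) : Usage → Prop
  | .linear => True
  | .affine => s.IsAffine
  | .relevant => s.IsRelevant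
  | .cartesian => s.IsAffine ∧ s.IsRelevant

theorem IsAlgebraic.of_isIsomorphic {A B : PreAlg E S} {s t : QSpan Q A.carrier B.carrier}
    (h : s.IsIsomorphic t) (hs : s.IsAlgebraic A B) : t.IsAlgebraic A B := by
  obtain ⟨i, h1, h2, h3⟩ := h
  intro σ T x
  obtain ⟨U, e, y, he, y1, y2, y3⟩ := hs σ T fun j => x j ≫ i.inv
  refine ⟨U, e, y ≫ i.hom, he, ?_, ?_, ?_⟩
  · simpa [← h1] using y1
  · simpa [← h2] using y2
  · simpa [← h3] using y3

theorem IsAffine.of_isIsomorphic {A B : E} {s t : QSpan Q A B}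
    (h : s.IsIsomorphic t) (hs : s.IsAffine) : t.IsAffine := by
  obtain ⟨i, h1, h2, h3⟩ := h
  intro T x₁ x₂
  simpa [← h3] using hs T (x₁ ≫ i.inv) (x₂ ≫ i.inv)

theorem IsRelevant.of_isIsomorphic {A B : E} {s t : QSpan Q A B}
    (h : s.IsIsomorphic t) (hs : s.IsRelevant) : t.IsRelevant := by
  obtain ⟨i, h1, h2, h3⟩ := h
  intro T x
  simpa [← h3] using hs T (x ≫ i.inv)

theorem HasUsage.of_isIsomorphic {A B : E} {s t : QSpan Q A B} {c : Usage}
    (h : s.IsIsomorphic t) (hs : s.HasUsage c) : t.HasUsage c := by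
  cases c with
  | linear => trivial
  | affine => exact IsAffine.of_isIsomorphic h hs
  | relevant => exact IsRelevant.of_isIsomorphic h hs
  | cartesian => exact ⟨IsAffine.of_isIsomorphic h hs.1, IsRelevant.of_isIsomorphic h hs.2⟩

/-- The graph of a homomorphism is algebraic. -/
theorem isAlgebraic_graph {A B : PreAlg E S} (f : A.carrier ⟶ B.carrier)
    (hf : ∀ σ, A.op σ ≫ f = Pi.lift (fun j => Pi.π _ j ≫ f) ≫ B.op σ) :
    (graph Q f).IsAlgebraic A B := by
  intro σ T x
  refine ⟨T, 𝟙 T, Pi.lift x ≫ A.op σ, inferInstance, ?_, ?_, ?_⟩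
  · simp
  · simp only [Category.assoc, hf, Category.id_comp]
    rw [lift_pi_comp_assoc]
  · have h1 : ∀ (V : E) (y : V ⟶ A.carrier), y ≫ (graph Q f).chr = 1 := fun V y =>
      MonObj.comp_one y
    simp only [h1, Finset.prod_const_one, MonObj.comp_one]
    exact Q.le_refl _

theorem hasUsage_graph {A B : E} (f : A ⟶ B) (c : Usage) : (graph Q f).HasUsage c := by
  have h1 : ∀ (V : E) (y : V ⟶ A), y ≫ (graph Q f).chr = 1 := fun V y => MonObj.comp_one y
  have ha : (graph Q f).IsAffine := fun T x₁ x₂ => by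
    rw [h1, h1, mul_one]; exact Q.le_refl _
  have hr : (graph Q f).IsRelevant := fun T x => by
    rw [h1, mul_one]; exact Q.le_refl _
  cases c with
  | linear => trivial
  | affine => exact ha
  | relevant => exact hr
  | cartesian => exact ⟨ha, hr⟩

theorem IsAlgebraic.comp {A B C : PreAlg E S} {s : QSpan Q A.carrier B.carrier}
    {t : QSpan Q B.carrier C.carrier} (hs : s.IsAlgebraic A B) (ht : t.IsAlgebraic B C) :
    (s.comp t).IsAlgebraic A C := by
  intro σ T x
  obtain ⟨U, e, y, he, y1, y2, y3⟩ := hs σ T fun j => x j ≫ pullback.fst _ _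
  obtain ⟨V, d, z, hd, z1, z2, z3⟩ := ht σ U fun j => e ≫ x j ≫ pullback.snd _ _
  have hw : (d ≫ y) ≫ s.right = z ≫ t.left := by
    rw [Category.assoc, y2, z1]
    simp only [pi_comp_lift_assoc, Category.assoc, pullback.condition]
  refine ⟨V, d ≫ e, pullback.lift (d ≫ y) z hw, epi_comp _ _, ?_, ?_, ?_⟩
  · simp only [pullback.lift_fst_assoc, y1, pi_comp_lift_assoc, Category.assoc]
  · simp only [pullback.lift_snd_assoc, z2, pi_comp_lift_assoc, Category.assoc]
  · have h := Q.mul_mono _ _ _ _ (y3.comp d) z3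
    simp only [comp_prod, Category.assoc] at h
    simp only [comp_prod, lift_mul', MonObj.comp_mul, Finset.prod_mul_distrib, Category.assoc,
      pullback.lift_fst_assoc, pullback.lift_snd_assoc]
    exact h

theorem IsAlgebraic.tensor {A B A' B' : PreAlg E S} {s : QSpan Q A.carrier B.carrier}
    {t : QSpan Q A'.carrier B'.carrier} (hs : s.IsAlgebraic A B) (ht : t.IsAlgebraic A' B') :
    IsAlgebraic (A.tensor A') (B.tensor B') (s.tensor t) := by
  intro σ T x
  obtain ⟨U, e, y, he, y1, y2, y3⟩ := hs σ T fun j => x j ≫ fst _ _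
  obtain ⟨V, d, z, hd, z1, z2, z3⟩ := ht σ U fun j => e ≫ x j ≫ snd _ _
  refine ⟨V, d ≫ e, lift (d ≫ y) z, epi_comp _ _, ?_, ?_, ?_⟩
  · rw [PreAlg.lift_tensor_op, lift_map, comp_lift]
    simp only [y1, z1, pi_comp_lift_assoc, Category.assoc, tensorHom_fst, tensorHom_snd]
  · rw [PreAlg.lift_tensor_op, lift_map, comp_lift]
    simp only [y2, z2, pi_comp_lift_assoc, Category.assoc, tensorHom_fst, tensorHom_snd]
  · have h := Q.mul_mono _ _ _ _ (y3.comp d) z3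
    simp only [comp_prod, Category.assoc] at h
    simp only [comp_prod, tensorHom_mul', MonObj.comp_mul, Finset.prod_mul_distrib,
      Category.assoc, lift_fst_assoc, lift_snd_assoc]
    exact h

theorem le_affine {T : E} {p q p' q' : T ⟶ Q.obj} (h : Q.Le (p * p') p) (h' : Q.Le (q * q') q) :
    Q.Le ((p * q) * (p' * q')) (p * q) := by
  rw [mul_mul_mul_comm]; exact Q.mul_mono _ _ _ _ h h'

theorem le_relevant {T : E} {p q : T ⟶ Q.obj} (h : Q.Le p (p * p)) (h' : Q.Le q (q * q)) :
    Q.Le (p * q) ((p * q) * (p * q)) := by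
  rw [mul_mul_mul_comm]; exact Q.mul_mono _ _ _ _ h h'

theorem HasUsage.comp {A B C : E} {s : QSpan Q A B} {t : QSpan Q B C} {c : Usage}
    (hs : s.HasUsage c) (ht : t.HasUsage c) : (s.comp t).HasUsage c := by
  have hc : ∀ (T : E) (x : T ⟶ (s.comp t).apex), x ≫ (s.comp t).chr =
      ((x ≫ pullback.fst _ _) ≫ s.chr) * ((x ≫ pullback.snd _ _) ≫ t.chr) := fun T x => by
    simp only [lift_mul', MonObj.comp_mul, Category.assoc]
  have ha : s.IsAffine → t.IsAffine → (s.comp t).IsAffine := fun h h' T x₁ x₂ => by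
    rw [hc, hc]; exact le_affine (h _ _ _) (h' _ _ _)
  have hr : s.IsRelevant → t.IsRelevant → (s.comp t).IsRelevant := fun h h' T x => by
    rw [hc]; exact le_relevant (h _ _) (h' _ _)
  cases c with
  | linear => trivial
  | affine => exact ha hs ht
  | relevant => exact hr hs ht
  | cartesian => exact ⟨ha hs.1 ht.1, hr hs.2 ht.2⟩

theorem HasUsage.tensor {A B C D : E} {s : QSpan Q A B} {t : QSpan Q C D} {c : Usage}
    (hs : s.HasUsage c) (ht : t.HasUsage c) : (s.tensor t).HasUsage c := by
  have hc : ∀ (T : E) (x : T ⟶ (s.tensor t).apex), x ≫ (s.tensor t).chr =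
      ((x ≫ fst _ _) ≫ s.chr) * ((x ≫ snd _ _) ≫ t.chr) := fun T x => by
    simp only [tensorHom_mul', MonObj.comp_mul, Category.assoc]
  have ha : s.IsAffine → t.IsAffine → (s.tensor t).IsAffine := fun h h' T x₁ x₂ => by
    rw [hc, hc]; exact le_affine (h _ _ _) (h' _ _ _)
  have hr : s.IsRelevant → t.IsRelevant → (s.tensor t).IsRelevant := fun h h' T x => by
    rw [hc]; exact le_relevant (h _ _) (h' _ _)
  cases c with
  | linear => trivial
  | affine => exact ha hs ht
  | relevant => exact hr hs ht
  | cartesian => exact ⟨ha hs.1 ht.1, hr hs.2 ht.2⟩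

end QSpan

open QSpan

namespace SpanClass

variable {Q : OrdCommMonoid E} {S : OpSig.{w}}

/-- An isomorphism class of `Q`-spans is algebraic if its representatives are. -/
def IsAlgebraic (A B : PreAlg E S) (m : SpanClass Q A.carrier B.carrier) : Prop :=
  ∀ s, mk s = m → s.IsAlgebraic A B

/-- Linear, affine, relevant and cartesian isomorphism classes of `Q`-spans. -/
def HasUsage {A B : E} (c : Usage) (m : SpanClass Q A B) : Prop :=
  ∀ s, mk s = m → s.HasUsage c

theorem isAlgebraic_mk {A B : PreAlg E S} {s : QSpan Q A.carrier B.carrier} :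
    IsAlgebraic A B (mk s) ↔ s.IsAlgebraic A B :=
  ⟨fun h => h s rfl, fun h t ht =>
    QSpan.IsAlgebraic.of_isIsomorphic (Quotient.exact ht.symm : s.IsIsomorphic t) h⟩

theorem hasUsage_mk {A B : E} {c : Usage} {s : QSpan Q A B} :
    HasUsage c (mk s) ↔ s.HasUsage c :=
  ⟨fun h => h s rfl, fun h t ht =>
    QSpan.HasUsage.of_isIsomorphic (Quotient.exact ht.symm : s.IsIsomorphic t) h⟩

/-- The morphisms of the category of linear (affine, relevant, cartesian) algebraic `Q`-spans. -/
def IsMor (c : Usage) (A B : PreAlg E S) (m : SpanClass Q A.carrier B.carrier) : Prop :=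
  IsAlgebraic A B m ∧ HasUsage c m

theorem IsMor.comp {c : Usage} {A B C : PreAlg E S} {m : SpanClass Q A.carrier B.carrier}
    {n : SpanClass Q B.carrier C.carrier} (hm : IsMor c A B m) (hn : IsMor c B C n) :
    IsMor c A C (m.comp n) := by
  obtain ⟨s, rfl⟩ := exists_rep m
  obtain ⟨t, rfl⟩ := exists_rep n
  exact ⟨isAlgebraic_mk.2 ((isAlgebraic_mk.1 hm.1).comp (isAlgebraic_mk.1 hn.1)),
    hasUsage_mk.2 ((hasUsage_mk.1 hm.2).comp (hasUsage_mk.1 hn.2))⟩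

theorem IsMor.tensor {c : Usage} {A B A' B' : PreAlg E S} {m : SpanClass Q A.carrier B.carrier}
    {n : SpanClass Q A'.carrier B'.carrier} (hm : IsMor c A B m) (hn : IsMor c A' B' n) :
    IsMor c (A.tensor A') (B.tensor B') (m.tensor n) := by
  obtain ⟨s, rfl⟩ := exists_rep m
  obtain ⟨t, rfl⟩ := exists_rep n
  exact ⟨isAlgebraic_mk.2 ((isAlgebraic_mk.1 hm.1).tensor (isAlgebraic_mk.1 hn.1)),
    hasUsage_mk.2 ((hasUsage_mk.1 hm.2).tensor (hasUsage_mk.1 hn.2))⟩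

theorem isMor_graph {c : Usage} {A B : PreAlg E S} (f : A.carrier ⟶ B.carrier)
    (hf : ∀ σ, A.op σ ≫ f = Pi.lift (fun j => Pi.π _ j ≫ f) ≫ B.op σ) :
    IsMor c A B (mk (graph Q f)) :=
  ⟨isAlgebraic_mk.2 (isAlgebraic_graph f hf), hasUsage_mk.2 (hasUsage_graph f c)⟩

end SpanClass

/-- The category of `(Σ, E)`-algebras and linear (affine, relevant, cartesian) algebraic `Q`-spans
(up to isomorphism of `Q`-spans). -/
@[ext]
structure AlgSpanCat (c : Usage) (S : Signature.{w}) (Q : OrdCommMonoid E) where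
  alg : Alg E S

variable {c : Usage} {S : Signature.{w}} {Q : OrdCommMonoid E}

noncomputable instance : Category.{max u v} (AlgSpanCat c S Q) where
  Hom A B := { m : SpanClass Q A.alg.carrier B.alg.carrier //
    SpanClass.IsMor c A.alg.toPreAlg B.alg.toPreAlg m }
  id A := ⟨SpanClass.mk (graph Q (𝟙 A.alg.carrier)), SpanClass.isMor_graph _ fun σ => by
    have h : Pi.lift (fun j => Pi.π (fun _ : Fin (S.arity σ) => A.alg.carrier) j ≫ 𝟙 _) =
        𝟙 (power A.alg.carrier (S.arity σ)) := by ext j; simp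
    rw [h, Category.comp_id, Category.id_comp]⟩
  comp m n := ⟨SpanClass.comp m.1 n.1, m.2.comp n.2⟩
  id_comp m := Subtype.ext (SpanClass.id_comp' m.1)
  comp_id m := Subtype.ext (SpanClass.comp_id' m.1)
  assoc m n l := Subtype.ext (SpanClass.assoc' m.1 n.1 l.1)

/-- The isomorphism in the category of algebraic `Q`-spans given by the graph of an isomorphism of
algebras. -/
noncomputable def AlgSpanCat.graphIso {A B : AlgSpanCat c S Q}
    (f : A.alg.carrier ≅ B.alg.carrier)
    (hf : ∀ σ, A.alg.op σ ≫ f.hom = Pi.lift (fun j => Pi.π _ j ≫ f.hom) ≫ B.alg.op σ) :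
    A ≅ B where
  hom := ⟨SpanClass.mk (graph Q f.hom), SpanClass.isMor_graph _ hf⟩
  inv := ⟨SpanClass.mk (graph Q f.inv), SpanClass.isMor_graph _ fun σ => by
    have h : Pi.lift (fun j => Pi.π (fun _ : Fin (S.arity σ) => B.alg.carrier) j ≫ f.inv) ≫
        Pi.lift (fun j => Pi.π (fun _ : Fin (S.arity σ) => A.alg.carrier) j ≫ f.hom) =
        𝟙 (power B.alg.carrier (S.arity σ)) := by ext j; simp
    rw [← cancel_mono f.hom, Category.assoc, Category.assoc, Iso.inv_hom_id, Category.comp_id, hf,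
      reassoc_of% h]⟩
  hom_inv_id := Subtype.ext (by
    refine (SpanClass.graph_comp f.hom f.inv).trans ?_
    rw [f.hom_inv_id]; rfl)
  inv_hom_id := Subtype.ext (by
    refine (SpanClass.graph_comp f.inv f.hom).trans ?_
    rw [f.inv_hom_id]; rfl)

/-- The functor to the category of `Q`-spans that forgets the operations. -/
noncomputable def AlgSpanCat.forget (c : Usage) (S : Signature.{w}) (Q : OrdCommMonoid E) :
    AlgSpanCat c S Q ⥤ SpanCat Q where
  obj A := ⟨A.alg.carrier⟩
  map m := m.1
  map_id _ := rfl
  map_comp _ _ := rfl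

/-- The monoidal operations on algebraic `Q`-spans, inherited from the finite products in `E`. -/
noncomputable instance : MonoidalCategoryStruct (AlgSpanCat c S Q) where
  tensorObj A B := ⟨A.alg.tensor B.alg⟩
  tensorHom m n := ⟨SpanClass.tensor m.1 n.1, m.2.tensor n.2⟩
  whiskerLeft A _ _ m := ⟨SpanClass.tensor (𝟙 A : A ⟶ A).1 m.1, (𝟙 A : A ⟶ A).2.tensor m.2⟩
  whiskerRight m A := ⟨SpanClass.tensor m.1 (𝟙 A : A ⟶ A).1, m.2.tensor (𝟙 A : A ⟶ A).2⟩
  tensorUnit := ⟨Alg.unit E S⟩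
  associator A B C := AlgSpanCat.graphIso (A := ⟨(A.alg.tensor B.alg).tensor C.alg⟩)
    (B := ⟨A.alg.tensor (B.alg.tensor C.alg)⟩)
    (α_ A.alg.carrier B.alg.carrier C.alg.carrier) fun σ => by
      refine CartesianMonoidalCategory.hom_ext _ _ ?_
        (CartesianMonoidalCategory.hom_ext _ _ ?_ ?_)
      all_goals simp only [PreAlg.lift_tensor_op, lift_fst, lift_snd, lift_fst_assoc,
        lift_snd_assoc, Category.assoc, associator_hom_fst, associator_hom_snd_fst,
        associator_hom_snd_snd, lift_pi_comp_assoc, comp_lift]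
  leftUnitor A := AlgSpanCat.graphIso (A := ⟨(Alg.unit E S).tensor A.alg⟩) (λ_ A.alg.carrier)
    fun σ => by
      simp only [leftUnitor_hom, lift_snd]
  rightUnitor A := AlgSpanCat.graphIso (A := ⟨A.alg.tensor (Alg.unit E S)⟩) (ρ_ A.alg.carrier)
    fun σ => by
      simp only [rightUnitor_hom, lift_fst]

noncomputable instance : MonoidalCategory (AlgSpanCat c S Q) where
  tensorHom_def f g := Subtype.ext (MonoidalCategory.tensorHom_def
    ((AlgSpanCat.forget c S Q).map f) ((AlgSpanCat.forget c S Q).map g))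
  id_tensorHom_id A B := Subtype.ext (MonoidalCategory.id_tensorHom_id
    ((AlgSpanCat.forget c S Q).obj A) ((AlgSpanCat.forget c S Q).obj B))
  tensorHom_comp_tensorHom f₁ f₂ g₁ g₂ := Subtype.ext (MonoidalCategory.tensorHom_comp_tensorHom
    ((AlgSpanCat.forget c S Q).map f₁) ((AlgSpanCat.forget c S Q).map f₂)
    ((AlgSpanCat.forget c S Q).map g₁) ((AlgSpanCat.forget c S Q).map g₂))
  whiskerLeft_id A B := Subtype.ext (MonoidalCategory.whiskerLeft_id
    ((AlgSpanCat.forget c S Q).obj A) ((AlgSpanCat.forget c S Q).obj B))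
  id_whiskerRight A B := Subtype.ext (MonoidalCategory.id_whiskerRight
    ((AlgSpanCat.forget c S Q).obj A) ((AlgSpanCat.forget c S Q).obj B))
  associator_naturality f g h := Subtype.ext (MonoidalCategory.associator_naturality
    ((AlgSpanCat.forget c S Q).map f) ((AlgSpanCat.forget c S Q).map g)
    ((AlgSpanCat.forget c S Q).map h))
  leftUnitor_naturality f := Subtype.ext (MonoidalCategory.leftUnitor_naturality
    ((AlgSpanCat.forget c S Q).map f))
  rightUnitor_naturality f := Subtype.ext (MonoidalCategory.rightUnitor_naturality
    ((AlgSpanCat.forget c S Q).map f))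
  pentagon W X Y Z := Subtype.ext (MonoidalCategory.pentagon
    ((AlgSpanCat.forget c S Q).obj W) ((AlgSpanCat.forget c S Q).obj X)
    ((AlgSpanCat.forget c S Q).obj Y) ((AlgSpanCat.forget c S Q).obj Z))
  triangle X Y := Subtype.ext (MonoidalCategory.triangle
    ((AlgSpanCat.forget c S Q).obj X) ((AlgSpanCat.forget c S Q).obj Y))

end AlgebraicSpans

/-- A functor between monoidal categories is strict monoidal if it is a monoidal functor whose
structure morphisms are identities. -/
def IsStrictMonoidal {C : Type*} [Category* C] [MonoidalCategory C] {D : Type*} [Category* D]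
    [MonoidalCategory D] (F : C ⥤ D) : Prop :=
  ∃ _ : F.Monoidal,
    (∃ h : 𝟙_ D = F.obj (𝟙_ C), Functor.LaxMonoidal.ε F = eqToHom h) ∧
    ∀ X Y : C, ∃ h : F.obj X ⊗ F.obj Y = F.obj (X ⊗ Y), Functor.LaxMonoidal.μ F X Y = eqToHom h

end QSpans

open QSpans

/-!
An algebraic span realizes every operation symbol on its apex, up to passing to a cover of the
stage. By induction on terms it realizes every derived operation `t` as well, provided that each
variable contributes `χ` with its number of occurrences in `t`
(`QSpan.IsAlgebraic.exists_derived`). Realizations for the arguments of an operation symbol are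
chosen one after the other, each at the stage where the previous ones live, so composing
epimorphisms suffices to find a common cover (`exists_common_cover`).

What remains is to compare `χ x₁ ⊗ ⋯ ⊗ χ xₙ` with the product that counts occurrences. The class of
the term and the class of the span match: a variable can be missing only if the span is affine, and
then `χ xₖ` is absorbed by the value `χ x` at the realization; it can be repeated only if the span
is relevant, and then `χ xₖ` is duplicated (`OrdCommMonoid.Le.prod_of_prod_pow`). Hence a span of
class `c` that is algebraic for an algebra structure is algebraic for every reduct along a
`c`-interpretation (`QSpan.IsAlgebraic.reduct`), and taking reducts is a functor that leaves spans
unchanged. Derived operations of products are computed componentwise, so this functor preserves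
tensor products on the nose; its structure morphisms are identities on underlying spans, and all
coherence laws follow from the unit laws for the composition of spans.
-/

namespace QSpans

/-! ### Derived operations and soundness of equational logic -/

section Algebras

variable {E : Type u} [Category.{v} E] [HasFiniteProducts E]

theorem PreAlg.derived_subst {S : OpSig.{w}} (A : PreAlg E S) {m n : ℕ} (f : Fin m → Term S n)
    (t : Term S m) : A.derived (t.subst f) = Pi.lift (fun k => A.derived (f k)) ≫ A.derived t := by
  induction t with
  | var k => simp [Term.subst, PreAlg.derived]
  | app σ ts ih => simp only [Term.subst, PreAlg.derived, ih, pi_comp_lift_assoc]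

theorem PreAlg.derived_app_var {S : OpSig.{w}} (A : PreAlg E S) (σ : S.Op) :
    A.derived (.app σ .var) = A.op σ := by
  have h : Pi.lift (fun j => Pi.π (fun _ : Fin (S.arity σ) => A.carrier) j) =
      𝟙 (power A.carrier (S.arity σ)) := by ext j; simp
  simp only [PreAlg.derived, h, Category.id_comp]

theorem PreAlg.derived_reduct {S T : OpSig.{w}} (i : ∀ σ : S.Op, Term T (S.arity σ))
    (A : PreAlg E T) {n : ℕ} (t : Term S n) :
    (A.reduct i).derived t = A.derived (t.translate i) := by
  induction t with
  | var k => rfl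
  | app σ ts ih =>
    simp only [Term.translate, PreAlg.derived_subst, ← ih]
    rfl

theorem PreAlg.reduct_id {S : OpSig.{w}} (A : PreAlg E S) :
    A.reduct (fun σ => .app σ .var) = A :=
  congrArg (PreAlg.mk A.carrier) (funext A.derived_app_var)

theorem PreAlg.reduct_reduct {S T U : OpSig.{w}} (i : ∀ σ : S.Op, Term T (S.arity σ))
    (j : ∀ σ : T.Op, Term U (T.arity σ)) (A : PreAlg E U) :
    (A.reduct j).reduct i = A.reduct fun σ => (i σ).translate j :=
  congrArg (PreAlg.mk A.carrier) (funext fun σ => A.derived_reduct j (i σ))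

theorem Alg.derived_eq_of_provable {S : Signature.{w}} (A : Alg E S) {n : ℕ}
    {s t : Term S.toOpSig n} (h : Provable S s t) :
    A.toPreAlg.derived s = A.toPreAlg.derived t := by
  induction h with
  | ax h f => rw [PreAlg.derived_subst, PreAlg.derived_subst, A.sat _ _ _ h]
  | refl t => rfl
  | symm _ ih => exact ih.symm
  | trans _ _ ih1 ih2 => exact ih1.trans ih2
  | congr σ _ ih => simp only [PreAlg.derived, ih]

/-- The algebra with the same underlying object in which each operation symbol is interpreted by
the derived operation that an interpretation of signatures assigns to it. -/
noncomputable def Alg.reduct {c : Usage} {S T : Signature.{w}} (i : Interpretation c S T)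
    (A : Alg E T) : Alg E S where
  toPreAlg := A.toPreAlg.reduct i.term
  sat n s t h := by
    rw [PreAlg.derived_reduct, PreAlg.derived_reduct]
    exact A.derived_eq_of_provable (i.sound n s t h)

theorem Alg.toPreAlg_injective {S : Signature.{w}} {A B : Alg E S}
    (h : A.toPreAlg = B.toPreAlg) : A = B := by
  cases A; cases B; cases h; rfl

end Algebras

theorem PreAlg.reduct_unit {E : Type u} [Category.{v} E] [CartesianMonoidalCategory E]
    [HasFiniteLimits E] {S T : OpSig.{w}} (i : ∀ σ : S.Op, Term T (S.arity σ)) :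
    (PreAlg.unit E T).reduct i = PreAlg.unit E S :=
  congrArg (PreAlg.mk (𝟙_ E)) (funext fun _ => toUnit_unique _ _)

/-! ### Weakening and contraction -/

section Ordered

variable {E : Type u} [Category.{v} E] [CartesianMonoidalCategory E] [BraidedCategory E]

theorem OrdCommMonoid.Le.le_pow {Q : OrdCommMonoid E} {T : E} {p : T ⟶ Q.obj}
    (h : Q.Le p (p * p)) {n : ℕ} (hn : 1 ≤ n) : Q.Le p (p ^ n) := by
  induction n, hn using Nat.le_induction with
  | base => rw [pow_one]; exact Q.le_refl _
  | succ n _ ih =>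
    rw [pow_succ]
    exact Q.le_trans _ _ _ h (Q.mul_mono _ _ _ _ ih (Q.le_refl _))

theorem OrdCommMonoid.Le.mul_prod_le {Q : OrdCommMonoid E} {T : E} {J : Type*} (s : Finset J)
    {p : J → (T ⟶ Q.obj)} {q : T ⟶ Q.obj} (h : ∀ k ∈ s, Q.Le (q * p k) q) :
    Q.Le (q * ∏ k ∈ s, p k) q := by
  classical
  induction s using Finset.induction_on with
  | empty => rw [Finset.prod_empty, mul_one]; exact Q.le_refl _
  | insert a s ha ih =>
    rw [Finset.prod_insert ha, ← mul_assoc]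
    exact Q.le_trans _ _ _
      (Q.mul_mono _ _ _ _ (h a (Finset.mem_insert_self a s)) (Q.le_refl _))
      (ih fun k hk => h k (Finset.mem_insert_of_mem hk))

/-- Multiplicities in a product below `q` may be replaced by `1` if the factors that occur more than
once can be duplicated, and the factors that do not occur can be absorbed by `q`. The absorption is
asked of `q` rather than of the product, as `p ≤ 1` need not hold for an affine span. -/
theorem OrdCommMonoid.Le.prod_of_prod_pow {Q : OrdCommMonoid E} {T : E} {J : Type*} [Fintype J]
    {p : J → (T ⟶ Q.obj)} {q : T ⟶ Q.obj} {m : J → ℕ} (h : Q.Le (∏ k, p k ^ m k) q)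
    (hdel : ∀ k, m k = 0 → Q.Le (q * p k) q) (hdup : ∀ k, 1 < m k → Q.Le (p k) (p k * p k)) :
    Q.Le (∏ k, p k) q := by
  classical
  -- The factors that occur; the others have exponent zero and drop out of the product of powers.
  have hpow : Q.Le (∏ k with m k ≠ 0, p k) q := by
    refine Q.le_trans _ _ _ (OrdCommMonoid.Le.prod _ fun k hk => ?_)
      ((Finset.prod_filter_of_ne (s := Finset.univ) (p := fun k => m k ≠ 0)
        (f := fun k => p k ^ m k) fun k _ hk h0 => hk (by rw [h0, pow_zero])).symm ▸ h)
    have hk0 : m k ≠ 0 := (Finset.mem_filter.1 hk).2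
    obtain h1 | h1 := (Nat.one_le_iff_ne_zero.2 hk0).eq_or_lt
    · rw [← h1, pow_one]; exact Q.le_refl _
    · exact (hdup k h1).le_pow h1.le
  rw [← Finset.prod_filter_mul_prod_filter_not Finset.univ (fun k => m k ≠ 0)]
  exact Q.le_trans _ _ _ (Q.mul_mono _ _ _ _ hpow (Q.le_refl _))
    (OrdCommMonoid.Le.mul_prod_le _ fun k hk =>
      hdel k (not_not.1 (Finset.mem_filter.1 hk).2))

end Ordered

/-! ### Algebraic spans and derived operations -/

/-- If at every stage over `T` each of finitely many properties can be realized after passing to a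
cover, then all of them can be realized on one common cover. The properties have to be stable
under change of stage. The covers are composed one after the other, so that no pullback of an
epimorphism is needed. -/
theorem exists_common_cover {E : Type u} [Category.{v} E] {X T : E} {n : ℕ}
    (P : Fin n → ∀ U : E, (U ⟶ T) → (U ⟶ X) → Prop)
    (hP : ∀ j (U V : E) (d : V ⟶ U) (e : U ⟶ T) (y : U ⟶ X), P j U e y → P j V (d ≫ e) (d ≫ y))
    (h : ∀ j (U : E) (e : U ⟶ T), ∃ (V : E) (d : V ⟶ U) (y : V ⟶ X), Epi d ∧ P j V (d ≫ e) y) :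
    ∃ (U : E) (e : U ⟶ T) (y : Fin n → (U ⟶ X)), Epi e ∧ ∀ j, P j U e (y j) := by
  induction n with
  | zero => exact ⟨T, 𝟙 T, Fin.elim0, inferInstance, fun j => j.elim0⟩
  | succ n ih =>
    obtain ⟨U, e, y, he, hy⟩ := ih (fun j => P j.succ) (fun j => hP j.succ) (fun j => h j.succ)
    obtain ⟨V, d, z, hd, hz⟩ := h 0 U e
    exact ⟨V, d ≫ e, Fin.cons z fun j => d ≫ y j, epi_comp _ _,
      Fin.cases hz fun j => hP _ _ _ _ _ _ (hy j)⟩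

section AlgebraicSpans

variable {E : Type u} [Category.{v} E] [CartesianMonoidalCategory E] [BraidedCategory E]
  [HasFiniteLimits E]

theorem PreAlg.reduct_tensor {S T : OpSig.{w}} (i : ∀ σ : S.Op, Term T (S.arity σ))
    (A B : PreAlg E T) : (A.tensor B).reduct i = (A.reduct i).tensor (B.reduct i) :=
  congrArg (PreAlg.mk (A.carrier ⊗ B.carrier)) (funext fun σ => A.derived_tensor B (i σ))

namespace QSpan

variable {Q : OrdCommMonoid E}

/-- The defining property of an algebraic span extends from operation symbols to terms `t`, if each
variable is counted with its number of occurrences: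
`∀ x₁ … xₙ, ∃ x, f x = t(f x₁, …) ∧ g x = t(g x₁, …) ∧ ⨂ₖ (χ xₖ) ^ (t.count k) ≤ χ x`. -/
theorem IsAlgebraic.exists_derived {S : OpSig.{w}} {A B : PreAlg E S}
    {s : QSpan Q A.carrier B.carrier} (hs : s.IsAlgebraic A B) {n : ℕ} (t : Term S n) (T : E)
    (x : Fin n → (T ⟶ s.apex)) :
    ∃ (U : E) (e : U ⟶ T) (y : U ⟶ s.apex), Epi e ∧
      y ≫ s.left = e ≫ Pi.lift (fun k => x k ≫ s.left) ≫ A.derived t ∧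
      y ≫ s.right = e ≫ Pi.lift (fun k => x k ≫ s.right) ≫ B.derived t ∧
      Q.Le (∏ k, (e ≫ x k ≫ s.chr) ^ t.count k) (y ≫ s.chr) := by
  induction t generalizing T with
  | var i =>
    refine ⟨T, 𝟙 T, x i, inferInstance, ?_, ?_, ?_⟩
    · simp [PreAlg.derived]
    · simp [PreAlg.derived]
    · simp only [Category.id_comp, Term.count, pow_ite, pow_one, pow_zero,
        Finset.prod_ite_eq, Finset.mem_univ, if_true]
      exact Q.le_refl _
  | app σ ts ih =>
    obtain ⟨U, e, y, he, hy⟩ := exists_common_cover (X := s.apex) (T := T)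
      (fun j U e y => y ≫ s.left = e ≫ Pi.lift (fun k => x k ≫ s.left) ≫ A.derived (ts j) ∧
        y ≫ s.right = e ≫ Pi.lift (fun k => x k ≫ s.right) ≫ B.derived (ts j) ∧
        Q.Le (∏ k, (e ≫ x k ≫ s.chr) ^ (ts j).count k) (y ≫ s.chr))
      (by
        rintro j U V d e y ⟨h1, h2, h3⟩
        refine ⟨by simp only [Category.assoc, h1], by simp only [Category.assoc, h2], ?_⟩
        have := h3.comp d
        simpa only [comp_prod, MonObj.comp_pow, Category.assoc] using this)
      (by
        intro j U e
        obtain ⟨V, d, y, hd, h1, h2, h3⟩ := ih j U fun k => e ≫ x k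
        refine ⟨V, d, y, hd, ?_, ?_, ?_⟩
        · simpa only [pi_comp_lift_assoc, Category.assoc] using h1
        · simpa only [pi_comp_lift_assoc, Category.assoc] using h2
        · simpa only [Category.assoc] using h3)
    obtain ⟨V, d, z, hd, h1, h2, h3⟩ := hs σ U y
    refine ⟨V, d ≫ e, z, epi_comp _ _, ?_, ?_, ?_⟩
    · simp only [h1, PreAlg.derived, (hy _).1, pi_comp_lift_assoc, Category.assoc]
    · simp only [h2, PreAlg.derived, (hy _).2.1, pi_comp_lift_assoc, Category.assoc]
    · refine Q.le_trans _ _ _ ?_ h3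
      have := (OrdCommMonoid.Le.prod Finset.univ fun j _ => (hy j).2.2).comp d
      rw [Finset.prod_comm] at this
      simp only [comp_prod, MonObj.comp_pow, Finset.prod_pow_eq_pow_sum] at this
      simp only [comp_prod, Category.assoc, Term.count]
      exact this

/-- The only step where the class of the terms has to match the class of the span: a variable can be
missing from a term only in the affine and cartesian cases, and repeated only in the relevant and
cartesian cases. -/
theorem IsAlgebraic.reduct {S T : OpSig.{w}} {c : Usage} {i : ∀ σ : S.Op, Term T (S.arity σ)}
    (hi : ∀ σ, (i σ).HasUsage c) {A B : PreAlg E T} {s : QSpan Q A.carrier B.carrier}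
    (hs : s.IsAlgebraic A B) (hc : s.HasUsage c) :
    IsAlgebraic (A.reduct i) (B.reduct i) s := by
  intro σ T x
  obtain ⟨U, e, y, he, h1, h2, h3⟩ := hs.exists_derived (i σ) T x
  refine ⟨U, e, y, he, h1, h2, ?_⟩
  rw [comp_prod]
  refine h3.prod_of_prod_pow (fun k hk => ?_) (fun k hk => ?_)
  -- Affinity is applied with the realization `y` as the element that is kept; this covers terms
  -- without any variable, too.
  · have hdel (ha : s.IsAffine) : Q.Le ((y ≫ s.chr) * (e ≫ x k ≫ s.chr)) (y ≫ s.chr) := by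
      simpa only [Category.assoc] using ha U y (e ≫ x k)
    have hu := hi σ
    cases c with
    | linear => have := hu k; omega
    | affine => exact hdel hc
    | relevant => have := hu k; omega
    | cartesian => exact hdel hc.1
  · have hdup (hr : s.IsRelevant) :
        Q.Le (e ≫ x k ≫ s.chr) ((e ≫ x k ≫ s.chr) * (e ≫ x k ≫ s.chr)) := by
      simpa only [Category.assoc] using hr U (e ≫ x k)
    have hu := hi σ
    cases c with
    | linear => have := hu k; omega
    | affine => have := hu k; omega
    | relevant => exact hdup hc
    | cartesian => exact hdup hc.2

end QSpan

theorem SpanClass.IsMor.reduct {Q : OrdCommMonoid E} {S T : OpSig.{w}} {c : Usage}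
    {i : ∀ σ : S.Op, Term T (S.arity σ)} (hi : ∀ σ, (i σ).HasUsage c) {A B : PreAlg E T}
    {m : SpanClass Q A.carrier B.carrier} (hm : IsMor c A B m) :
    IsMor c (A.reduct i) (B.reduct i) m :=
  ⟨fun s hs => (hm.1 s hs).reduct hi (hm.2 s hs), hm.2⟩

/-! ### The functor induced by an interpretation -/

section

open QSpan

variable {Q : OrdCommMonoid E}

/-- The identities are given by equations, so that the lemma applies to spans between objects that
are equal to `X`, `Y` and `X ⊗ Y` by definition, but not syntactically. -/
theorem SpanClass.tensor_comp_comp_of_eq_id {X Y Z : E} {e : SpanClass Q X X}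
    {e' : SpanClass Q Y Y} {m : SpanClass Q (X ⊗ Y) (X ⊗ Y)} (he : e = mk (graph Q (𝟙 X)))
    (he' : e' = mk (graph Q (𝟙 Y))) (hm : m = mk (graph Q (𝟙 (X ⊗ Y))))
    (l : SpanClass Q (X ⊗ Y) Z) : comp (tensor e e') (comp m l) = l := by
  rw [he, he', hm, tensor_graph, id_tensorHom_id, id_comp', id_comp']

theorem SpanClass.comp_tensor_comp_of_eq_id {X Y Z : E} {e : SpanClass Q X X}
    {e' : SpanClass Q Y Y} {m : SpanClass Q (X ⊗ Y) (X ⊗ Y)} (he : e = mk (graph Q (𝟙 X)))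
    (he' : e' = mk (graph Q (𝟙 Y))) (hm : m = mk (graph Q (𝟙 (X ⊗ Y))))
    (l : SpanClass Q Z (X ⊗ Y)) : comp l (comp (tensor e e') m) = l := by
  rw [he, he', hm, tensor_graph, id_tensorHom_id, comp_id', comp_id']

end

namespace AlgSpanCat

open QSpan

variable {c : Usage} {Q : OrdCommMonoid E}

/-- The functor on algebraic `Q`-spans induced by an interpretation: it takes reducts of algebras
and does not change the spans. -/
noncomputable def reduct (Q : OrdCommMonoid E) {S T : Signature.{w}} (i : Interpretation c S T) :
    AlgSpanCat c T Q ⥤ AlgSpanCat c S Q where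
  obj A := ⟨A.alg.reduct i⟩
  map m := ⟨m.1, m.2.reduct i.usage⟩
  map_id _ := rfl
  map_comp _ _ := rfl

theorem ext_toPreAlg {S : Signature.{w}} {A B : AlgSpanCat c S Q}
    (h : A.alg.toPreAlg = B.alg.toPreAlg) : A = B :=
  AlgSpanCat.ext (Alg.toPreAlg_injective h)

/-- As forgetting the operations is faithful, the transports along the equalities of objects need
to be compared on underlying spans only. -/
theorem functor_ext {C : Type*} [Category* C] {S : Signature.{w}} {F G : C ⥤ AlgSpanCat c S Q}
    (hobj : ∀ X, F.obj X = G.obj X) (hmap : F ⋙ forget c S Q = G ⋙ forget c S Q) : F = G := by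
  refine CategoryTheory.Functor.ext hobj fun X Y f => Subtype.ext ?_
  have h := Functor.congr_hom hmap f
  have h' : (forget c S Q).map (F.map f) =
      (forget c S Q).map (eqToHom (hobj X) ≫ G.map f ≫ eqToHom (hobj Y).symm) := by
    simp only [Functor.map_comp, eqToHom_map]
    exact h
  exact h'

theorem reduct_id (S : SigCat.{w} c) : reduct Q (𝟙 S : S ⟶ S) = 𝟭 (AlgSpanCat c S.sig Q) :=
  functor_ext (fun A => ext_toPreAlg A.alg.toPreAlg.reduct_id) rfl

theorem reduct_comp {S T U : SigCat.{w} c} (i : S ⟶ T) (j : T ⟶ U) :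
    reduct Q (i ≫ j) = reduct Q j ⋙ reduct Q i :=
  functor_ext (fun A => ext_toPreAlg (A.alg.toPreAlg.reduct_reduct i.term j.term).symm) rfl

section Monoidal

variable {S T : Signature.{w}} (i : Interpretation c S T)

theorem reduct_unit : 𝟙_ (AlgSpanCat c S Q) = (reduct Q i).obj (𝟙_ (AlgSpanCat c T Q)) :=
  ext_toPreAlg (PreAlg.reduct_unit i.term).symm

theorem reduct_tensor (A B : AlgSpanCat c T Q) :
    (reduct Q i).obj A ⊗ (reduct Q i).obj B = (reduct Q i).obj (A ⊗ B) :=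
  ext_toPreAlg (PreAlg.reduct_tensor i.term A.alg.toPreAlg B.alg.toPreAlg).symm

/-- The underlying objects of the two units agree by definition, so the transport between them
disappears on underlying spans. -/
theorem eqToHom_reduct_unit_val :
    (eqToHom (reduct_unit (Q := Q) i)).1 = SpanClass.mk (graph Q (𝟙 (𝟙_ E))) :=
  eqToHom_map (forget c S Q) (reduct_unit i)

/-- The underlying objects of the two tensor products agree by definition, so the transport between
them disappears on underlying spans. -/
theorem eqToHom_reduct_tensor_val (A B : AlgSpanCat c T Q) :
    (eqToHom (reduct_tensor i A B)).1 =
      SpanClass.mk (graph Q (𝟙 (A.alg.carrier ⊗ B.alg.carrier))) :=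
  eqToHom_map (forget c S Q) (reduct_tensor i A B)

/-- The strict monoidal structure on the reduct functor. All coherence laws reduce to the unit laws
of span composition, as the structure morphisms are identities on underlying spans. -/
noncomputable def reductCoreMonoidal : (reduct Q i).CoreMonoidal where
  εIso := eqToIso (reduct_unit i)
  μIso A B := eqToIso (reduct_tensor i A B)
  μIso_hom_natural_left {A B} f C := Subtype.ext (by
    change SpanClass.comp (SpanClass.tensor f.1 (SpanClass.mk (graph Q (𝟙 C.alg.carrier))))
        (eqToHom (reduct_tensor i B C)).1 =
      SpanClass.comp (eqToHom (reduct_tensor i A C)).1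
        (SpanClass.tensor f.1 (SpanClass.mk (graph Q (𝟙 C.alg.carrier))))
    rw [eqToHom_reduct_tensor_val, eqToHom_reduct_tensor_val]
    exact (SpanClass.comp_id' _).trans (SpanClass.id_comp' _).symm)
  μIso_hom_natural_right {A B} C f := Subtype.ext (by
    change SpanClass.comp (SpanClass.tensor (SpanClass.mk (graph Q (𝟙 C.alg.carrier))) f.1)
        (eqToHom (reduct_tensor i C B)).1 =
      SpanClass.comp (eqToHom (reduct_tensor i C A)).1
        (SpanClass.tensor (SpanClass.mk (graph Q (𝟙 C.alg.carrier))) f.1)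
    rw [eqToHom_reduct_tensor_val, eqToHom_reduct_tensor_val]
    exact (SpanClass.comp_id' _).trans (SpanClass.id_comp' _).symm)
  associativity A B C := Subtype.ext <|
    (SpanClass.tensor_comp_comp_of_eq_id (eqToHom_reduct_tensor_val i A B) rfl
      (eqToHom_reduct_tensor_val i (A ⊗ B) C) _).trans
    (SpanClass.comp_tensor_comp_of_eq_id rfl (eqToHom_reduct_tensor_val i B C)
      (eqToHom_reduct_tensor_val i A (B ⊗ C)) _).symm
  left_unitality A := Subtype.ext
    (SpanClass.tensor_comp_comp_of_eq_id (eqToHom_reduct_unit_val i) rfl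
      (eqToHom_reduct_tensor_val i (𝟙_ _) A) _).symm
  right_unitality A := Subtype.ext
    (SpanClass.tensor_comp_comp_of_eq_id rfl (eqToHom_reduct_unit_val i)
      (eqToHom_reduct_tensor_val i A (𝟙_ _)) _).symm

theorem isStrictMonoidal_reduct : IsStrictMonoidal (reduct Q i) :=
  ⟨(reductCoreMonoidal i).toMonoidal, ⟨reduct_unit i, rfl⟩,
    fun A B => ⟨reduct_tensor i A B, rfl⟩⟩

end Monoidal

end AlgSpanCat

end AlgebraicSpans

end QSpans

open QSpans
theorem mainTheorem8 {E : Type u} [Category.{v} E] [CartesianMonoidalCategory E]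
    [BraidedCategory E] [HasFiniteLimits E] [MonoidalClosed E] [HasSubobjectClassifier E]
    (Q : OrdCommMonoid E) (c : Usage) :
    ∃ star : ∀ {S₁ S₂ : SigCat.{w} c}, (S₁ ⟶ S₂) →
        (AlgSpanCat c S₂.sig Q ⥤ AlgSpanCat c S₁.sig Q),
      (∀ {S₁ S₂ : SigCat.{w} c} (i : S₁ ⟶ S₂),
        IsStrictMonoidal (star i) ∧
        (∀ A : AlgSpanCat c S₂.sig Q,
          ((star i).obj A).alg.toPreAlg = A.alg.toPreAlg.reduct i.term) ∧
        (∀ {A B : AlgSpanCat c S₂.sig Q} (m : A ⟶ B), HEq ((star i).map m).1 m.1)) ∧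
      (∀ S : SigCat.{w} c, star (𝟙 S) = 𝟭 (AlgSpanCat c S.sig Q)) ∧
      (∀ {S₁ S₂ S₃ : SigCat.{w} c} (i : S₁ ⟶ S₂) (j : S₂ ⟶ S₃),
        star (i ≫ j) = star j ⋙ star i) :=
  ⟨fun i => AlgSpanCat.reduct Q i,
    fun i => ⟨AlgSpanCat.isStrictMonoidal_reduct i, fun _ => rfl, fun _ => HEq.rfl⟩,
    AlgSpanCat.reduct_id, AlgSpanCat.reduct_comp⟩
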